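/- **Theorem 5.13.** Let $\mathcal U\subset\mathbf C^2$ be a domain equipped with a $C^1$ foliation $\mathcal F$ by complex analytic curves; that is, $\mathcal U$ is covered by foliated charts which are (real) $C^1$ diffeomorphisms $\varphi=(\varphi_1,\varphi_2)$ from open subsets of $\mathcal U$ onto open boxes $D\times T\subset\mathbf R^2\times\mathbf R^2$ with $D$ connected, whose changes of charts locally preserve the plaques $\{\varphi_2=t\}$, and whose plaques are one-dimensional complex submanifolds; the leaf through a point consists of all points that can be joined to it by a finite chain of plaques. Let $\mathcal E\subset\mathcal U$ be a relatively closed subset which is a union of leaves of $\mathcal F$ and satisfies $\mathcal H^3(\mathcal E)=0$, where $\mathcal H^3$ is the 3-dimensional Hausdorff measure. Let $f$ be holomorphic on $\mathcal U\setminus\mathcal E$, let $p\in\mathcal E$, and suppose that $f$ extends holomorphically to a neighborhood of $p$, i.e. there are an open set $V_0$ with $p\in V_0\subset\mathcal U$ and a holomorphic function $F_0$ on $V_0$ with $F_0=f$ on $V_0\setminus\mathcal E$. Then $f$ extends holomorphically to a neighborhood of the whole leaf $L$ of $\mathcal F$ containing $p$: there are an open set $V$ with $L\subset V\subset\mathcal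 U$ and a holomorphic function $F$ on $V$ with $F=f$ on $V\setminus\mathcal E$. -/

import Mathlib

open Set Topology MeasureTheory

/-- The space `ℂ²` with its Euclidean (Hermitian) norm. -/
abbrev C2 : Type := EuclideanSpace ℂ (Fin 2)

/-- `S ⊆ ℂ²` is an embedded complex analytic curve (a one-dimensional complex submanifold, not
necessarily closed in `ℂ²`): near each of its points it is the zero set of a holomorphic function
whose differential does not vanish at that point. The empty set is allowed. -/
def IsComplexCurve (S : Set C2) : Prop :=
  ∀ q ∈ S, ∃ N : Set C2, IsOpen N ∧ q ∈ N ∧ ∃ g : C2 → ℂ,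
    DifferentiableOn ℂ g N ∧ fderiv ℂ g q ≠ 0 ∧ S ∩ N = {x ∈ N | g x = 0}

/-- The plaque of height `t` of a chart `φ` with values in a product: the level set
`{φ₂ = t}` of the transverse coordinate. -/
def plaque (φ : OpenPartialHomeomorph C2 (ℂ × ℂ)) (t : ℂ) : Set C2 :=
  {x ∈ φ.source | (φ x).2 = t}

/-- A `C¹` foliation of the set `U ⊆ ℂ²` (open in all uses) by complex analytic curves, given by a
foliated atlas. The model space `ℂ × ℂ` is only used as the real vector space `ℝ² × ℝ²`: the charts
are `C¹` diffeomorphisms in the real sense. The first factor is the direction along the leaves, the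
second one is the transverse direction. -/
structure C1CurveFoliation (U : Set C2) where
  /-- the foliated charts (flow boxes) -/
  atlas : Set (OpenPartialHomeomorph C2 (ℂ × ℂ))
  source_subset : ∀ φ ∈ atlas, φ.source ⊆ U
  cover : ∀ x ∈ U, ∃ φ ∈ atlas, x ∈ φ.source
  /-- every chart maps onto an open box `D × T` with connected leaf factor, so that its nonempty
  plaques are connected -/
  box : ∀ φ ∈ atlas, ∃ D T : Set ℂ, IsOpen D ∧ IsConnected D ∧ IsOpen T ∧ φ.target = D ×ˢ T
  contDiffOn : ∀ φ ∈ atlas, ContDiffOn ℝ 1 φ φ.source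
  contDiffOn_symm : ∀ φ ∈ atlas, ContDiffOn ℝ 1 φ.symm φ.target
  /-- on overlaps, the charts define locally the same plaques, that is, the changes of charts are
  locally of the form `(s, t) ↦ (a(s, t), b(t))` with `b` injective -/
  compatible : ∀ φ ∈ atlas, ∀ ψ ∈ atlas, ∀ x ∈ φ.source ∩ ψ.source,
    ∃ N ∈ 𝓝 x, N ⊆ φ.source ∩ ψ.source ∧
      ∀ y ∈ N, ∀ z ∈ N, (φ y).2 = (φ z).2 ↔ (ψ y).2 = (ψ z).2
  /-- the leaves are complex analytic curves -/
  isComplexCurve_plaque : ∀ φ ∈ atlas, ∀ t : ℂ, IsComplexCurve (plaque φ t)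

namespace C1CurveFoliation

/-- Two points lie on a common plaque of the foliation. -/
def SamePlaque {U : Set C2} (ℱ : C1CurveFoliation U) (x y : C2) : Prop :=
  ∃ φ ∈ ℱ.atlas, ∃ t : ℂ, x ∈ plaque φ t ∧ y ∈ plaque φ t

/-- The leaf through `x`: all points that can be reached from `x` by a finite chain of plaques. -/
def leaf {U : Set C2} (ℱ : C1CurveFoliation U) (x : C2) : Set C2 :=
  {y | Relation.ReflTransGen ℱ.SamePlaque x y}

/-- `E` is a union of leaves of the foliation of `U`. -/
def IsUnionOfLeaves {U : Set C2} (ℱ : C1CurveFoliation U) (E : Set C2) : Prop :=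
  ∃ S ⊆ U, E = ⋃ x ∈ S, ℱ.leaf x

end C1CurveFoliation

/-- A function `f`, of which only the values on `U \ E` matter, extends holomorphically to a
neighbourhood of `S` in `U`. -/
def ExtendsHolomorphicallyNear (U E : Set C2) (f : C2 → ℂ) (S : Set C2) : Prop :=
  ∃ V : Set C2, IsOpen V ∧ S ⊆ V ∧ V ⊆ U ∧
    ∃ F : C2 → ℂ, DifferentiableOn ℂ F V ∧ EqOn F f (V \ E)

/-! Extendability at a point is an open condition, and local extensions glue: on overlaps they equal
`f` off `E`, and the complement of `E` is dense. It remains to propagate extendability along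
plaques, which by connectedness is a local matter.

Near a point, choose complex-linear coordinates `(z, w)` in which the plaques are graphs `w = g (z,
t)` over a disc `B`, with height function `τ`; there `E` is a union of graphs (`GraphBox`). The
image of `E` under `(z, w) ↦ (z, |τ - t₀|)` is `𝓗³`-null in the 3-dimensional space `ℂ × ℝ`. By
saturation it is a product over `B`, so arbitrarily small radii `r` are missed by the heights of `E`
(`exists_notMem_image`): the tube `|t - t₀| ≤ r` has a wall free of `E`.

Let `A` be the set of `z ∈ B` over which `f` extends at every point of the tube. It is open. Let `z'
∈ B` be a limit of `A` and `(z', w') ∈ E` a point of the tube, hence off its wall. The same argument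
gives a small circle around `w'` avoiding `E` in the slice `z'`, hence in nearby slices, bounding
discs inside the tube. The Cauchy integral over this circle is holomorphic on a bidisc, and agrees
with the extension near a slice `z'' ∈ A`. It then equals `f` on the whole bidisc off `E`, since an
`𝓗³`-null set does not disconnect it (`extendsAt_of_slice`). So `A` is closed in `B`, and `A = B`
(`extendsAt_graph`). -/

section General
open Metric Filter

/-! ### Hausdorff-null sets: empty interior and non-separation -/

/-- A subset of a finite-dimensional real normed space which is null for the Hausdorff measure of
top dimension has empty interior. -/
theorem interior_eq_empty_of_hausdorffMeasure_finrank {X : Type*} [NormedAddCommGroup X]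
    [NormedSpace ℝ X] [FiniteDimensional ℝ X] [MeasurableSpace X] [BorelSpace X] {s : Set X}
    (hs : Measure.hausdorffMeasure (Module.finrank ℝ X : ℝ) s = 0) : interior s = ∅ := by
  have h := isAddHaarMeasure_hausdorffMeasure (E := X)
  by_contra hne
  exact (isOpen_interior.measure_pos _ (nonempty_iff_ne_empty.2 hne)).ne'
    (measure_mono_null interior_subset hs)

theorem LipschitzOnWith.hausdorffMeasure_image_eq_zero {X Y : Type*} [EMetricSpace X]
    [MeasurableSpace X] [BorelSpace X] [EMetricSpace Y] [MeasurableSpace Y] [BorelSpace Y]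
    {K : NNReal} {h : X → Y} {s t : Set X} {d : ℝ} (hh : LipschitzOnWith K h t) (hst : s ⊆ t)
    (hd : 0 ≤ d) (hs : Measure.hausdorffMeasure d s = 0) :
    Measure.hausdorffMeasure d (h '' s) = 0 := by
  have := (hh.mono hst).hausdorffMeasure_image_le hd
  rw [hs, mul_zero] at this
  exact le_antisymm this zero_le

/-- A relatively closed set of codimension greater than one does not disconnect a convex open
set. -/
theorem Convex.isPreconnected_sdiff_of_hausdorffMeasure {X : Type*} [NormedAddCommGroup X]
    [NormedSpace ℝ X] [FiniteDimensional ℝ X] [MeasurableSpace X] [BorelSpace X] {n : ℕ}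
    (hn : Module.finrank ℝ X = n + 1) {P E : Set X} (hP : Convex ℝ P)
    (hPE : IsOpen (P \ E)) (hE : Measure.hausdorffMeasure (n : ℝ) E = 0) :
    IsPreconnected (P \ E) := by
  refine isPreconnected_of_forall_pair fun a ha b hb => ?_
  by_cases hab : a = b
  · subst hab
    exact ⟨{a}, by simpa using ha, rfl, rfl, isPreconnected_singleton⟩
  have hv : b - a ≠ 0 := sub_ne_zero.2 (Ne.symm hab)
  obtain ⟨q, hq⟩ := Submodule.exists_isCompl (ℝ ∙ (b - a))
  have hfin : Module.finrank ℝ q = n := by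
    have h1 := Submodule.finrank_add_eq_of_isCompl hq
    rw [finrank_span_singleton hv] at h1
    omega
  set π : X →L[ℝ] q := (Submodule.projectionOnto q _ hq.symm).toContinuousLinearMap with hπ
  have hπq : ∀ s : q, π s = s := fun s => Submodule.projectionOnto_apply_left hq.symm s
  have hπv : π (b - a) = 0 := by
    exact (Submodule.projectionOnto_apply_eq_zero_iff hq.symm).2
      (Submodule.mem_span_singleton_self _)
  have hnull : Measure.hausdorffMeasure (Module.finrank ℝ q : ℝ) (π '' E) = 0 := by
    rw [hfin]
    exact (π.lipschitz.lipschitzOnWith (s := univ)).hausdorffMeasure_image_eq_zero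
      (subset_univ _) n.cast_nonneg hE
  have hint := interior_eq_empty_of_hausdorffMeasure_finrank hnull
  obtain ⟨ε, hε, hεa⟩ := Metric.isOpen_iff.1 hPE a ha
  obtain ⟨ε', hε', hεb⟩ := Metric.isOpen_iff.1 hPE b hb
  -- Every line parallel to `b - a` is a fibre of `π`. The fibre over `s` misses `E`, so a small
  -- translation by `c` moves the segment from `a` to `b` off `E`.
  obtain ⟨s, hs, hsE⟩ : ∃ s ∈ ball (π a) (min ε ε'), s ∉ π '' E := by
    by_contra! hcon
    have : π a ∈ interior (π '' E) :=
      mem_interior.2 ⟨_, hcon, isOpen_ball, mem_ball_self (lt_min hε hε')⟩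
    simp [hint] at this
  set c : X := ((s - π a : q) : X) with hc
  have hcn : ‖c‖ < min ε ε' := by
    have : ‖s - π a‖ < min ε ε' := by simpa [dist_eq_norm] using hs
    simpa [hc] using this
  have hac : a + c ∈ ball a ε := by simpa using hcn.trans_le (min_le_left _ _)
  have hbc : b + c ∈ ball b ε' := by simpa using hcn.trans_le (min_le_right _ _)
  have hseg : segment ℝ (a + c) (b + c) ⊆ P \ E := by
    intro x hx
    refine ⟨hP.segment_subset (hεa hac).1 (hεb hbc).1 hx, fun hxE => hsE ⟨x, hxE, ?_⟩⟩
    rw [segment_eq_image'] at hx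
    obtain ⟨θ, -, rfl⟩ := hx
    have : b + c - (a + c) = b - a := by abel
    beta_reduce
    rw [this, map_add, map_smul, hπv, smul_zero, add_zero, map_add, hc, hπq, add_sub_cancel]
  refine ⟨ball a ε ∪ segment ℝ (a + c) (b + c) ∪ ball b ε',
    union_subset (union_subset hεa hseg) hεb, Or.inl (Or.inl (mem_ball_self hε)),
    Or.inr (mem_ball_self hε'), ?_⟩
  refine IsPreconnected.union (b + c) (Or.inr (right_mem_segment ℝ _ _)) hbc ?_
    (convex_ball b ε').isPreconnected
  exact IsPreconnected.union (a + c) hac (left_mem_segment ℝ _ _)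
    (convex_ball a ε).isPreconnected (convex_segment _ _).isPreconnected

/-! ### Holomorphic functions: identity theorem and parameter integrals -/

/-- The identity theorem for a ball in a complex normed space. -/
theorem eqOn_zero_ball_of_eventuallyEq_zero {X : Type*} [NormedAddCommGroup X] [NormedSpace ℂ X]
    {h : X → ℂ} {c y : X} {r : ℝ} (hh : DifferentiableOn ℂ h (ball c r)) (hy : y ∈ ball c r)
    (h0 : h =ᶠ[𝓝 y] 0) : EqOn h 0 (ball c r) := by
  intro x hx
  -- Restricting to the complex line through `y` and `x` reduces the claim to one variable; the line
  -- meets the ball in a convex set.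
  set ℓ : ℂ → X := fun s => y + s • (x - y) with hℓ
  have hℓd : Differentiable ℂ ℓ := by fun_prop
  have hconv : Convex ℝ (ℓ ⁻¹' ball c r) := by
    intro s hs s' hs' a b ha hb hab
    have : ℓ (a • s + b • s') = a • ℓ s + b • ℓ s' := by
      obtain rfl : b = 1 - a := by linarith
      simp only [hℓ, ← Complex.coe_smul]
      push_cast
      module
    rw [mem_preimage, this]
    exact convex_ball c r hs hs' ha hb hab
  have hop : IsOpen (ℓ ⁻¹' ball c r) := isOpen_ball.preimage hℓd.continuous
  have hd : DifferentiableOn ℂ (h ∘ ℓ) (ℓ ⁻¹' ball c r) :=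
    hh.comp hℓd.differentiableOn (mapsTo_preimage _ _)
  have h00 : ℓ 0 = y := by simp [hℓ]
  have h11 : ℓ 1 = x := by simp [hℓ]
  have key := (hd.analyticOnNhd hop).eqOn_zero_of_preconnected_of_eventuallyEq_zero
    hconv.isPreconnected (z₀ := 0) (by simpa [h00] using hy) (by
      have : Tendsto ℓ (𝓝 0) (𝓝 y) := by simpa [h00] using hℓd.continuous.tendsto 0
      exact this.eventually h0)
  have := key (x := 1) (by simpa [h11] using hx)
  simpa [h11] using this

/-- The identity theorem on preconnected open subsets of a complex normed space. -/
theorem eqOn_of_isPreconnected_of_eventuallyEq {X : Type*} [NormedAddCommGroup X]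
    [NormedSpace ℂ X] {F h : X → ℂ} {O : Set X} {y : X} (hO : IsOpen O) (hOc : IsPreconnected O)
    (hF : DifferentiableOn ℂ F O) (hh : DifferentiableOn ℂ h O) (hy : y ∈ O)
    (h0 : F =ᶠ[𝓝 y] h) : EqOn F h O := by
  have hd := hF.sub hh
  have h0' : ∀ x, (F - h =ᶠ[𝓝 x] 0) ↔ F =ᶠ[𝓝 x] h := fun x => by
    constructor <;> intro H <;> filter_upwards [H] with u hu
    · simpa [sub_eq_zero] using hu
    · simp [hu]
  have hsub : O ⊆ {x | F - h =ᶠ[𝓝 x] 0} := by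
    refine hOc.subset_of_closure_inter_subset
      (isOpen_setOfPred_eventually_nhds) ⟨y, hy, (h0' y).2 h0⟩ ?_
    rintro x ⟨hx, hxO⟩
    obtain ⟨r, hr, hrO⟩ := Metric.isOpen_iff.1 hO x hxO
    obtain ⟨u, hu, hux⟩ := Metric.mem_closure_iff.1 hx r hr
    have hzero := eqOn_zero_ball_of_eventuallyEq_zero (hd.mono hrO)
      (by rwa [mem_ball, dist_comm] : u ∈ ball x r) hu
    exact hzero.eventuallyEq_of_mem (ball_mem_nhds x hr)
  intro x hx
  exact ((h0' x).1 (hsub hx)).eq_of_nhds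

/-- The derivative in `x` of a jointly continuous family of holomorphic functions depends
continuously on the parameter. -/
theorem continuous_fderiv_of_differentiableOn {X : Type*} [NormedAddCommGroup X]
    [NormedSpace ℂ X] [FiniteDimensional ℂ X] {F : X → ℝ → ℂ} {O : Set X} (hO : IsOpen O)
    (hd : ∀ θ, DifferentiableOn ℂ (F · θ) O)
    (hc : ContinuousOn (Function.uncurry F) (O ×ˢ univ)) {x : X} (hx : x ∈ O) :
    Continuous fun θ => fderiv ℂ (F · θ) x := by
  rw [continuous_clm_apply]
  intro v
  obtain ⟨r, hr, hrO⟩ : ∃ r > 0, ∀ s ∈ closedBall (0 : ℂ) r, x + s • v ∈ O := by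
    have h1 : (fun s : ℂ => x + s • v) ⁻¹' O ∈ 𝓝 (0 : ℂ) :=
      (by fun_prop : Continuous fun s : ℂ => x + s • v).continuousAt.preimage_mem_nhds
        (by simpa using hO.mem_nhds hx)
    exact (Metric.nhds_basis_closedBall.mem_iff).1 h1
  -- Cauchy's formula on the complex line in direction `v` replaces the derivative by an integral of
  -- values, which are continuous in `θ`.
  have key : ∀ θ, fderiv ℂ (F · θ) x v = (2 * Real.pi * Complex.I : ℂ)⁻¹ •
      ∮ s in C(0, r), (1 / (s - 0) ^ 2) • F (x + s • v) θ := by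
    intro θ
    have hdl : DifferentiableOn ℂ (fun s : ℂ => F (x + s • v) θ) (closedBall 0 r) :=
      (hd θ).comp (by fun_prop : Differentiable ℂ fun s : ℂ => x + s • v).differentiableOn hrO
    rw [hdl.deriv_eq_smul_circleIntegral hr, inv_smul_smul₀ Complex.two_pi_I_ne_zero]
    have h0 : x + (0 : ℂ) • v = x := by simp
    have h1 : HasFDerivAt (F · θ) (fderiv ℂ (F · θ) x) (x + (0 : ℂ) • v) := by
      rw [h0]; exact ((hd θ).differentiableAt (hO.mem_nhds hx)).hasFDerivAt
    have h2 : HasDerivAt (fun s : ℂ => x + s • v) v 0 := by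
      simpa using ((hasDerivAt_id (0 : ℂ)).smul_const v).const_add x
    exact (h1.comp_hasDerivAt (0 : ℂ) h2).deriv.symm
  have hF : Continuous fun q : ℝ × ℝ => F (x + circleMap 0 r q.2 • v) q.1 := by
    have h3 := hc.comp_continuous (f := fun q : ℝ × ℝ => (x + circleMap 0 r q.2 • v, q.1))
      (by fun_prop) (fun q => ⟨hrO _ (circleMap_mem_closedBall 0 hr.le _), mem_univ _⟩)
    exact h3
  have hdc : Continuous fun q : ℝ × ℝ => deriv (circleMap 0 r) q.2 := by
    simp only [deriv_circleMap]; fun_prop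
  have hk : Continuous fun q : ℝ × ℝ => 1 / (circleMap 0 r q.2 - 0) ^ 2 :=
    Continuous.div₀ continuous_const (by fun_prop) fun q => by simpa using hr.ne'
  have hint : Continuous (Function.uncurry fun θ t : ℝ => deriv (circleMap 0 r) t •
      ((1 / (circleMap 0 r t - 0) ^ 2) • F (x + circleMap 0 r t • v) θ)) := hdc.smul (hk.smul hF)
  simp_rw [key, circleIntegral]
  exact (intervalIntegral.continuous_parametric_intervalIntegral_of_continuous' (μ := volume)
    hint _ _).const_smul (2 * Real.pi * Complex.I : ℂ)⁻¹

/-- Integrals of jointly continuous families of holomorphic functions are holomorphic. -/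
theorem differentiableOn_intervalIntegral {X : Type*} [NormedAddCommGroup X] [NormedSpace ℂ X]
    [FiniteDimensional ℂ X] {F : X → ℝ → ℂ} {O : Set X} (hO : IsOpen O)
    (hd : ∀ θ, DifferentiableOn ℂ (F · θ) O)
    (hc : ContinuousOn (Function.uncurry F) (O ×ˢ univ)) (a b : ℝ) :
    DifferentiableOn ℂ (fun x => ∫ θ in a..b, F x θ) O := by
  have : ProperSpace X := FiniteDimensional.proper ℂ X
  intro x₀ hx₀
  obtain ⟨r, hr, hrO⟩ := Metric.nhds_basis_closedBall.mem_iff.1 (hO.mem_nhds hx₀)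
  have hcompact : IsCompact (closedBall x₀ r ×ˢ uIcc a b) :=
    (isCompact_closedBall x₀ r).prod isCompact_uIcc
  obtain ⟨M, hM⟩ := hcompact.exists_bound_of_continuousOn
    (hc.mono (prod_mono hrO (subset_univ _)))
  have hcont : ∀ x ∈ O, Continuous (F x) := fun x hx =>
    hc.comp_continuous (f := fun θ => (x, θ)) (by fun_prop) fun θ => ⟨hx, mem_univ _⟩
  have hfd : ∀ θ, ∀ x ∈ O, HasFDerivAt (F · θ) (fderiv ℂ (F · θ) x) x := fun θ x hx =>
    ((hd θ).differentiableAt (hO.mem_nhds hx)).hasFDerivAt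
  have hsub : ball x₀ (r / 2) ⊆ O := fun x hx =>
    hrO (ball_subset_closedBall (ball_subset_ball (by linarith) hx))
  refine (intervalIntegral.hasFDerivAt_integral_of_dominated_of_fderiv_le
    (F' := fun x θ => fderiv ℂ (F · θ) x) (s := ball x₀ (r / 2))
    (bound := fun _ => (2 * M) / (r / 2)) (ball_mem_nhds _ (half_pos hr)) ?_
    ((hcont x₀ hx₀).intervalIntegrable a b)
    (continuous_fderiv_of_differentiableOn hO hd hc hx₀).aestronglyMeasurable
    ?_ intervalIntegrable_const ?_).differentiableAt.differentiableWithinAt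
  · filter_upwards [hO.mem_nhds hx₀] with x hx
    exact (hcont x hx).aestronglyMeasurable
  · refine Eventually.of_forall fun θ hθ x hx => ?_
    have hbs : ball x (r / 2) ⊆ closedBall x₀ r := fun y hy => by
      have h1 := dist_triangle y x x₀
      simp only [mem_ball] at hx hy
      rw [mem_closedBall]
      linarith
    have hb : ∀ y ∈ ball x (r / 2), ‖F y θ‖ ≤ M := fun y hy =>
      hM (y, θ) ⟨hbs hy, uIoc_subset_uIcc hθ⟩
    -- Cauchy estimate: on the ball of radius `r / 2` around `x` the values stay within `2 * M` of
    -- `F x θ`.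
    refine Complex.norm_fderiv_le_div_of_mapsTo_ball
      ((hd θ).mono (hbs.trans hrO)) (fun y hy => ?_) (half_pos hr)
    rw [mem_closedBall, dist_eq_norm]
    have := norm_sub_le (F y θ) (F x θ)
    have h1 := hb y hy
    have h2 := hb x (mem_ball_self (half_pos hr))
    linarith
  · exact Eventually.of_forall fun θ _ x hx => hfd θ x (hsub hx)

/-- The Cauchy integral in the second variable over a fixed circle of a function holomorphic near
`B × ∂Δ` is holomorphic on `B × Δ`. -/
theorem differentiableOn_cauchyIntegral_snd {f : ℂ × ℂ → ℂ} {O : Set (ℂ × ℂ)}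
    (hf : DifferentiableOn ℂ f O) {B : Set ℂ} (hB : IsOpen B) {c : ℂ} {ρ : ℝ} (hρ : 0 ≤ ρ)
    (hBO : B ×ˢ sphere c ρ ⊆ O) :
    DifferentiableOn ℂ (fun x : ℂ × ℂ => (2 * Real.pi * Complex.I : ℂ)⁻¹ •
      ∮ ζ in C(c, ρ), (ζ - x.2)⁻¹ • f (x.1, ζ)) (B ×ˢ ball c ρ) := by
  suffices h : DifferentiableOn ℂ (fun x : ℂ × ℂ => ∮ ζ in C(c, ρ), (ζ - x.2)⁻¹ • f (x.1, ζ))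
      (B ×ˢ ball c ρ) from h.const_smul (2 * Real.pi * Complex.I : ℂ)⁻¹
  have hmem : ∀ x ∈ B ×ˢ ball c ρ, ∀ θ, (x.1, circleMap c ρ θ) ∈ O := fun x hx θ =>
    hBO ⟨hx.1, circleMap_mem_sphere c hρ θ⟩
  have hne : ∀ x ∈ B ×ˢ ball c ρ, ∀ θ, circleMap c ρ θ - x.2 ≠ 0 := fun x hx θ =>
    sub_ne_zero.2 (circleMap_ne_mem_ball hx.2 θ)
  have hd : ∀ θ, DifferentiableOn ℂ (fun x : ℂ × ℂ => deriv (circleMap c ρ) θ •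
      ((circleMap c ρ θ - x.2)⁻¹ • f (x.1, circleMap c ρ θ))) (B ×ˢ ball c ρ) := fun θ => by
    have h1 : DifferentiableOn ℂ (fun x : ℂ × ℂ => (circleMap c ρ θ - x.2)⁻¹) (B ×ˢ ball c ρ) :=
      DifferentiableOn.inv (by fun_prop) fun x hx => hne x hx θ
    have h2 : DifferentiableOn ℂ (fun x : ℂ × ℂ => f (x.1, circleMap c ρ θ)) (B ×ˢ ball c ρ) :=
      hf.comp (f := fun x : ℂ × ℂ => (x.1, circleMap c ρ θ)) (by fun_prop)
        fun x hx => hmem x hx θ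
    exact (h1.smul h2).const_smul (deriv (circleMap c ρ) θ)
  have hc : ContinuousOn (Function.uncurry fun (x : ℂ × ℂ) (θ : ℝ) => deriv (circleMap c ρ) θ •
      ((circleMap c ρ θ - x.2)⁻¹ • f (x.1, circleMap c ρ θ))) ((B ×ˢ ball c ρ) ×ˢ univ) := by
    have h1 : ContinuousOn (fun q : (ℂ × ℂ) × ℝ => f (q.1.1, circleMap c ρ q.2))
        ((B ×ˢ ball c ρ) ×ˢ univ) :=
      hf.continuousOn.comp (f := fun q : (ℂ × ℂ) × ℝ => (q.1.1, circleMap c ρ q.2))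
        (by fun_prop) fun q hq => hmem q.1 hq.1 q.2
    have h2 : ContinuousOn (fun q : (ℂ × ℂ) × ℝ => (circleMap c ρ q.2 - q.1.2)⁻¹)
        ((B ×ˢ ball c ρ) ×ˢ univ) :=
      ContinuousOn.inv₀ (by fun_prop) fun q hq => hne q.1 hq.1 q.2
    have h3 : ContinuousOn (fun q : (ℂ × ℂ) × ℝ => deriv (circleMap c ρ) q.2)
        ((B ×ˢ ball c ρ) ×ˢ univ) := by
      simp only [deriv_circleMap]; fun_prop
    exact h3.smul (h2.smul h1)
  simp only [circleIntegral]
  exact differentiableOn_intervalIntegral (hB.prod isOpen_ball) hd hc _ _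

/-! ### Pointwise extendability and gluing -/

/-- `f` extends holomorphically across the point `q`. -/
def ExtendsAt {X : Type*} [NormedAddCommGroup X] [NormedSpace ℂ X] (U E : Set X) (f : X → ℂ)
    (q : X) : Prop :=
  ∃ V : Set X, IsOpen V ∧ q ∈ V ∧ V ⊆ U ∧
    ∃ F : X → ℂ, DifferentiableOn ℂ F V ∧ EqOn F f (V \ E)

section ExtendsAt
variable {X : Type*} [NormedAddCommGroup X] [NormedSpace ℂ X] {U E : Set X} {f : X → ℂ}

theorem isOpen_setOf_extendsAt : IsOpen {q | ExtendsAt U E f q} := by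
  refine isOpen_iff_mem_nhds.2 fun q hq => ?_
  obtain ⟨V, hV, hqV, hVU, hF⟩ := hq
  filter_upwards [hV.mem_nhds hqV] with y hy
  exact ⟨V, hV, hy, hVU, hF⟩

theorem extendsAt_of_notMem (hUE : IsOpen (U \ E)) (hf : DifferentiableOn ℂ f (U \ E)) {q : X}
    (hqU : q ∈ U) (hqE : q ∉ E) : ExtendsAt U E f q :=
  ⟨U \ E, hUE, ⟨hqU, hqE⟩, sdiff_subset, f, hf, fun _ _ => rfl⟩

/-- Local extensions across a set with empty interior glue to a single extension. -/
theorem exists_differentiableOn_extension (hE : interior E = ∅) :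
    ∃ F : X → ℂ, DifferentiableOn ℂ F {q | ExtendsAt U E f q} ∧
      EqOn F f ({q | ExtendsAt U E f q} \ E) := by
  classical
  have hch : ∀ q : X, ∃ (V : Set X) (F : X → ℂ), ExtendsAt U E f q →
      IsOpen V ∧ q ∈ V ∧ DifferentiableOn ℂ F V ∧ EqOn F f (V \ E) := by
    intro q
    by_cases h : ExtendsAt U E f q
    · obtain ⟨V, hV, hqV, -, F, hF, hFf⟩ := h
      exact ⟨V, F, fun _ => ⟨hV, hqV, hF, hFf⟩⟩
    · exact ⟨∅, 0, fun h' => absurd h' h⟩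
  choose V F hVF using hch
  have hdense : Dense Eᶜ := interior_eq_empty_iff_dense_compl.1 hE
  refine ⟨fun q => F q q, fun q hq => ?_, fun q hq => ?_⟩
  · obtain ⟨hV, hqV, hF, hFf⟩ := hVF q hq
    have hev : (fun y => F y y) =ᶠ[𝓝 q] F q := by
      filter_upwards [hV.mem_nhds hqV, isOpen_setOf_extendsAt.mem_nhds hq] with y hy hyext
      obtain ⟨hV', hyV', hF', hFf'⟩ := hVF y hyext
      have hO : IsOpen (V y ∩ V q) := hV'.inter hV
      -- Both local extensions equal `f` off `E`, which is dense, so by continuity they agree at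
      -- `y`.
      have hcl : y ∈ closure ((V y ∩ V q) ∩ Eᶜ) :=
        hdense.open_subset_closure_inter hO ⟨hyV', hy⟩
      have heq : EqOn (F y) (F q) ((V y ∩ V q) ∩ Eᶜ) := fun x hx =>
        (hFf' ⟨hx.1.1, hx.2⟩).trans (hFf ⟨hx.1.2, hx.2⟩).symm
      have := mem_closure_iff_nhdsWithin_neBot.1 hcl
      have t1 : Tendsto (F y) (𝓝[(V y ∩ V q) ∩ Eᶜ] y) (𝓝 (F y y)) :=
        ((hF'.continuousOn.continuousAt (hV'.mem_nhds hyV')).tendsto).mono_left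
          nhdsWithin_le_nhds
      have t2 : Tendsto (F q) (𝓝[(V y ∩ V q) ∩ Eᶜ] y) (𝓝 (F q y)) :=
        ((hF.continuousOn.continuousAt (hV.mem_nhds hy)).tendsto).mono_left
          nhdsWithin_le_nhds
      exact tendsto_nhds_unique (t1.congr' (heq.eventuallyEq_of_mem self_mem_nhdsWithin)) t2
    exact ((hF.differentiableAt (hV.mem_nhds hqV)).congr_of_eventuallyEq
      hev).differentiableWithinAt
  · obtain ⟨-, hqV, -, hFf⟩ := hVF q hq.1
    exact hFf ⟨hqV, hq.2⟩

end ExtendsAt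

/-- The ambient real dimension is 4, and `𝓗⁴ ≤ 𝓗³`. -/
theorem interior_eq_empty_of_hausdorffMeasure_three {E : Set (ℂ × ℂ)}
    (hE : Measure.hausdorffMeasure (3 : ℝ) E = 0) : interior E = ∅ := by
  refine interior_eq_empty_of_hausdorffMeasure_finrank ?_
  refine le_antisymm ((Measure.hausdorffMeasure_mono ?_ E).trans hE.le) zero_le
  simp [Complex.finrank_real_complex]
  norm_num

/-! ### Continuity principle -/

/-- The continuity principle: a function which is holomorphic near `{|z - z'| < δ, |w - w'| = ρ}`
and extends across the disc `{z''} × {|w - w'| ≤ ρ}` extends across the point `(z', w')`. -/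
theorem extendsAt_of_slice {U E : Set (ℂ × ℂ)} {f : ℂ × ℂ → ℂ} (hUE : IsOpen (U \ E))
    (hf : DifferentiableOn ℂ f (U \ E)) (hE : Measure.hausdorffMeasure (3 : ℝ) E = 0)
    {z' w' z'' : ℂ} {δ ρ : ℝ} (hρ : 0 < ρ) (hU : ball z' δ ×ˢ ball w' ρ ⊆ U)
    (hS : ball z' δ ×ˢ sphere w' ρ ⊆ U \ E) (hz'' : z'' ∈ ball z' δ)
    (hext : ∀ w ∈ closedBall w' ρ, ExtendsAt U E f (z'', w)) : ExtendsAt U E f (z', w') := by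
  have hint := interior_eq_empty_of_hausdorffMeasure_three hE
  obtain ⟨G, hG, hGf⟩ := exists_differentiableOn_extension (U := U) (f := f) hint
  set F : ℂ × ℂ → ℂ := fun x => (2 * Real.pi * Complex.I : ℂ)⁻¹ •
      ∮ ζ in C(w', ρ), (ζ - x.2)⁻¹ • f (x.1, ζ) with hFdef
  have hF : DifferentiableOn ℂ F (ball z' δ ×ˢ ball w' ρ) :=
    differentiableOn_cauchyIntegral_snd hf isOpen_ball hρ.le hS
  obtain ⟨u, v, hu, hv, hzu, hwv, huv⟩ := generalized_tube_lemma (isCompact_singleton (x := z''))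
    (isCompact_closedBall w' ρ) (isOpen_setOf_extendsAt (U := U) (E := E) (f := f)) (by
      rintro ⟨z, w⟩ ⟨hz, hw⟩
      obtain rfl : z = z'' := hz
      exact hext w hw)
  have hz''u : z'' ∈ u := hzu rfl
  -- Near the slice `z''` the glued extension `G` is holomorphic on the full disc with boundary
  -- values `f`, so Cauchy's formula identifies it with `F`.
  have hFG : EqOn F G ((u ∩ ball z' δ) ×ˢ ball w' ρ) := by
    rintro ⟨z, w⟩ ⟨⟨hz, hzδ⟩, hw⟩
    have hdisc : DifferentiableOn ℂ (fun ζ => G (z, ζ)) (closedBall w' ρ) :=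
      hG.comp (f := fun ζ : ℂ => (z, ζ)) (by fun_prop) fun ζ hζ => huv ⟨hz, hwv hζ⟩
    have hcauchy := hdisc.circleIntegral_sub_inv_smul hw
    have hcongr : (∮ ζ in C(w', ρ), (ζ - w)⁻¹ • f (z, ζ)) =
        ∮ ζ in C(w', ρ), (ζ - w)⁻¹ • G (z, ζ) := by
      refine circleIntegral.integral_congr hρ.le fun ζ hζ => ?_
      have : G (z, ζ) = f (z, ζ) :=
        hGf ⟨huv ⟨hz, hwv (sphere_subset_closedBall hζ)⟩, (hS (mk_mem_prod hzδ hζ)).2⟩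
      simp only [this]
    simp only [hFdef, hcongr, hcauchy]
    rw [smul_smul, inv_mul_cancel₀ Complex.two_pi_I_ne_zero, one_smul]
  have hPE : (ball z' δ ×ˢ ball w' ρ) \ E = (ball z' δ ×ˢ ball w' ρ) ∩ (U \ E) := by
    ext x
    exact ⟨fun h => ⟨h.1, hU h.1, h.2⟩, fun h => ⟨h.1, h.2.2⟩⟩
  have hopen : IsOpen ((ball z' δ ×ˢ ball w' ρ) \ E) := by
    rw [hPE]; exact (isOpen_ball.prod isOpen_ball).inter hUE
  have hconn : IsPreconnected ((ball z' δ ×ˢ ball w' ρ) \ E) :=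
    ((convex_ball z' δ).prod (convex_ball w' ρ)).isPreconnected_sdiff_of_hausdorffMeasure (n := 3)
      (by simp [Complex.finrank_real_complex]) hopen (by exact_mod_cast hE)
  have hO : IsOpen ((u ∩ ball z' δ) ×ˢ ball w' ρ) := (hu.inter isOpen_ball).prod isOpen_ball
  obtain ⟨y, hy, hyE⟩ : ∃ y ∈ (u ∩ ball z' δ) ×ˢ ball w' ρ, y ∉ E := by
    by_contra! hcon
    have : (z'', w') ∈ interior E :=
      mem_interior.2 ⟨_, hcon, hO, ⟨hz''u, hz''⟩, mem_ball_self hρ⟩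
    simp [hint] at this
  have hyP : y ∈ (ball z' δ ×ˢ ball w' ρ) \ E := ⟨⟨hy.1.2, hy.2⟩, hyE⟩
  have hev : F =ᶠ[𝓝 y] f := by
    filter_upwards [hO.mem_nhds hy, hopen.mem_nhds hyP] with x hx hxP
    exact (hFG hx).trans (hGf ⟨huv ⟨hx.1.1, hwv (ball_subset_closedBall hx.2)⟩, hxP.2⟩)
  have hFf := eqOn_of_isPreconnected_of_eventuallyEq hopen hconn (hF.mono sdiff_subset)
    (hf.mono (by rw [hPE]; exact inter_subset_right)) hyP hev
  have hδ : 0 < δ := dist_nonneg.trans_lt hz''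
  exact ⟨_, isOpen_ball.prod isOpen_ball, ⟨mem_ball_self hδ, mem_ball_self hρ⟩, hU, F, hF, hFf⟩

/-! ### Flow boxes as families of graphs -/

/-- Coordinates `(z, w) ↦ (z, τ (z, w))` with Lipschitz inverse `(z, t) ↦ (z, g (z, t))` from an
open set `W ⊆ U` onto a product `B × T`, in which `E` is a union of level sets of `τ`. -/
structure GraphBox (U E : Set (ℂ × ℂ)) where
  (B T : Set ℂ) (W : Set (ℂ × ℂ)) (τ g : ℂ × ℂ → ℂ) (Kτ Kg : NNReal)
  isOpen_B : IsOpen B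
  isPreconnected_B : IsPreconnected B
  nonempty_B : B.Nonempty
  isOpen_T : IsOpen T
  isOpen_W : IsOpen W
  W_subset : W ⊆ U
  graph_mem : ∀ z ∈ B, ∀ t ∈ T, (z, g (z, t)) ∈ W
  τ_graph : ∀ z ∈ B, ∀ t ∈ T, τ (z, g (z, t)) = t
  fst_mem : ∀ x ∈ W, x.1 ∈ B
  τ_mem : ∀ x ∈ W, τ x ∈ T
  g_τ : ∀ x ∈ W, g (x.1, τ x) = x.2
  lipschitz_τ : LipschitzOnWith Kτ τ W
  lipschitz_g : LipschitzOnWith Kg g (B ×ˢ T)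
  saturated : ∀ x ∈ W, ∀ y ∈ W, τ x = τ y → x ∈ E → y ∈ E

namespace GraphBox
variable {U E : Set (ℂ × ℂ)} (b : GraphBox U E)

/-- A Lipschitz function of the height omits arbitrary values on a saturated `𝓗³`-null set. -/
theorem exists_notMem_image (hE : Measure.hausdorffMeasure (3 : ℝ) E = 0) {u : ℂ → ℝ}
    {K : NNReal} (hu : LipschitzOnWith K u b.T) {l r : ℝ} (hlr : l < r) :
    ∃ ρ ∈ Ioo l r, ∀ x ∈ b.W, x ∈ E → u (b.τ x) ≠ ρ := by
  by_contra! hcon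
  have hlip : LipschitzOnWith (max 1 (K * b.Kτ)) (fun x : ℂ × ℂ => (x.1, u (b.τ x))) b.W :=
    (LipschitzWith.prod_fst.lipschitzOnWith).prodMk (hu.comp b.lipschitz_τ b.τ_mem)
  have hnull := hlip.hausdorffMeasure_image_eq_zero (s := b.W ∩ E) inter_subset_left
    (by norm_num) (measure_mono_null inter_subset_right hE)
  have hint : interior ((fun x : ℂ × ℂ => (x.1, u (b.τ x))) '' (b.W ∩ E)) = ∅ := by
    refine interior_eq_empty_of_hausdorffMeasure_finrank ?_
    have h3 : ((Module.finrank ℝ (ℂ × ℝ) : ℕ) : ℝ) = 3 := by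
      simp [Complex.finrank_real_complex]
    rw [h3]
    exact hnull
  -- One point of `E` at a height `t` puts the whole graph of height `t` in `E`, and this graph
  -- projects onto `B`.
  have hsub : b.B ×ˢ Ioo l r ⊆ (fun x : ℂ × ℂ => (x.1, u (b.τ x))) '' (b.W ∩ E) := by
    rintro ⟨z, ρ⟩ ⟨hz, hρ⟩
    obtain ⟨x, hx, hxE, hux⟩ := hcon ρ hρ
    have hy := b.graph_mem z hz _ (b.τ_mem x hx)
    have hτ := b.τ_graph z hz _ (b.τ_mem x hx)
    exact ⟨_, ⟨hy, b.saturated x hx _ hy hτ.symm hxE⟩, by simp only [hτ, hux]⟩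
  have hne : (b.B ×ˢ Ioo l r).Nonempty := b.nonempty_B.prod (nonempty_Ioo.2 hlr)
  have := interior_maximal hsub (b.isOpen_B.prod isOpen_Ioo)
  rw [hint] at this
  exact hne.ne_empty (subset_empty_iff.1 this)

/-- A connectedness argument in `z`, carried out for a whole tube of graphs around height `t₀`: the
continuity principle needs full discs in a neighbouring slice, not single points. -/
theorem extendsAt_graph {f : ℂ × ℂ → ℂ} (hUE : IsOpen (U \ E))
    (hf : DifferentiableOn ℂ f (U \ E)) (hE : Measure.hausdorffMeasure (3 : ℝ) E = 0)
    {z₁ z₂ t₀ : ℂ} (hz₁ : z₁ ∈ b.B) (hz₂ : z₂ ∈ b.B) (ht₀ : t₀ ∈ b.T)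
    (hext : ExtendsAt U E f (z₁, b.g (z₁, t₀))) : ExtendsAt U E f (z₂, b.g (z₂, t₀)) := by
  have hgc : ContinuousOn (fun x : ℂ × ℂ => (x.1, b.g x)) (b.B ×ˢ b.T) :=
    continuousOn_fst.prodMk b.lipschitz_g.continuousOn
  set O : Set (ℂ × ℂ) :=
    (b.B ×ˢ b.T) ∩ (fun x : ℂ × ℂ => (x.1, b.g x)) ⁻¹' {q | ExtendsAt U E f q} with hOdef
  have hO : IsOpen O :=
    hgc.isOpen_inter_preimage (b.isOpen_B.prod b.isOpen_T) isOpen_setOf_extendsAt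
  have hO₁ : (fun t => (z₁, t)) ⁻¹' O ∈ 𝓝 t₀ :=
    (by fun_prop : Continuous fun t : ℂ => (z₁, t)).continuousAt.preimage_mem_nhds
      (hO.mem_nhds ⟨⟨hz₁, ht₀⟩, hext⟩)
  obtain ⟨r₀, hr₀, hr₀O⟩ := Metric.nhds_basis_closedBall.mem_iff.1 hO₁
  obtain ⟨r, ⟨hr, hrr₀⟩, hrE⟩ := b.exists_notMem_image hE (u := fun t => dist t t₀)
    (LipschitzWith.dist_left t₀).lipschitzOnWith hr₀
  have hrO : ∀ t ∈ closedBall t₀ r, (z₁, t) ∈ O := fun t ht =>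
    hr₀O (closedBall_subset_closedBall hrr₀.le ht)
  have hrT : closedBall t₀ r ⊆ b.T := fun t ht => (hrO t ht).1.2
  set A : Set ℂ := {z | ∀ t ∈ closedBall t₀ r, (z, t) ∈ O} with hAdef
  have hA : IsOpen A := by
    refine isOpen_iff_mem_nhds.2 fun z hz => ?_
    obtain ⟨u, v, hu, -, hzu, htv, huv⟩ := generalized_tube_lemma (isCompact_singleton (x := z))
      (isCompact_closedBall t₀ r) hO (by
        rintro ⟨y, t⟩ ⟨hy, ht⟩
        obtain rfl : y = z := hy
        exact hz t ht)
    filter_upwards [hu.mem_nhds (hzu rfl)] with y hy t ht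
    exact huv ⟨hy, htv ht⟩
  suffices hBA : b.B ⊆ A from (hBA hz₂ t₀ (mem_closedBall_self hr.le)).2
  refine b.isPreconnected_B.subset_of_closure_inter_subset hA ⟨z₁, hz₁, hrO⟩ ?_
  rintro z' ⟨hz'A, hz'⟩ t ht
  have htT := hrT ht
  refine ⟨⟨hz', htT⟩, ?_⟩
  change ExtendsAt U E f (z', b.g (z', t))
  set w' := b.g (z', t) with hw'
  have hxW : (z', w') ∈ b.W := b.graph_mem z' hz' t htT
  have hτx : b.τ (z', w') = t := b.τ_graph z' hz' t htT
  by_cases hxE : (z', w') ∈ E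
  swap
  · exact extendsAt_of_notMem hUE hf (b.W_subset hxW) hxE
  -- The wall `|t - t₀| = r` is free of `E`, so there is room for a disc around `w'` inside the
  -- tube.
  have htr : t ∈ ball t₀ r := lt_of_le_of_ne ht (hτx ▸ hrE _ hxW hxE)
  have hW' : IsOpen (b.W ∩ b.τ ⁻¹' ball t₀ r) :=
    b.lipschitz_τ.continuousOn.isOpen_inter_preimage b.isOpen_W isOpen_ball
  obtain ⟨ρ₀, hρ₀, hρ₀W⟩ := Metric.nhds_basis_closedBall.mem_iff.1
    (hW'.mem_nhds (⟨hxW, by rwa [mem_preimage, hτx]⟩ : (z', w') ∈ b.W ∩ b.τ ⁻¹' ball t₀ r))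
  rw [← closedBall_prod_same] at hρ₀W
  have hglip : LipschitzOnWith b.Kg (fun s => b.g (z', s)) b.T := by
    have := b.lipschitz_g.comp (g := b.g) (f := fun s : ℂ => (z', s)) (s := b.T)
      (LipschitzWith.prodMk_left z').lipschitzOnWith fun s hs => ⟨hz', hs⟩
    simpa [Function.comp_def] using this
  -- On the slice `z'`, `g (z', τ)` is the coordinate `w`, so avoiding the value `ρ` means that the
  -- circle `|w - w'| = ρ` misses `E`.
  obtain ⟨ρ, ⟨hρ, hρρ₀⟩, hρE⟩ := b.exists_notMem_image hE (u := fun s => dist (b.g (z', s)) w')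
    (((LipschitzWith.dist_left w').lipschitzOnWith (s := univ)).comp hglip (mapsTo_univ _ _)) hρ₀
  have hsph : ({z'} : Set ℂ) ×ˢ sphere w' ρ ⊆ U \ E := by
    rintro ⟨z, w⟩ ⟨hz, hw⟩
    obtain rfl : z = z' := hz
    have hwW : (z, w) ∈ b.W := (hρ₀W ⟨mem_closedBall_self hρ₀.le,
      closedBall_subset_closedBall hρρ₀.le (sphere_subset_closedBall hw)⟩).1
    refine ⟨b.W_subset hwW, fun hwE => hρE _ hwW hwE ?_⟩
    have := b.g_τ _ hwW
    simp only at this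
    rw [this]
    exact hw
  obtain ⟨u, v, hu, -, hzu, hwv, huv⟩ := generalized_tube_lemma isCompact_singleton
    (isCompact_sphere w' ρ) hUE hsph
  obtain ⟨δ, hδ, hδu⟩ := Metric.isOpen_iff.1 hu z' (hzu rfl)
  obtain ⟨z'', hz''A, hz''⟩ := Metric.mem_closure_iff.1 hz'A _ (lt_min hδ hρ₀)
  have hsubW : ball z' (min δ ρ₀) ×ˢ closedBall w' ρ ⊆ b.W ∩ b.τ ⁻¹' ball t₀ r := by
    rintro ⟨z, w⟩ ⟨hz, hw⟩
    exact hρ₀W ⟨ball_subset_closedBall (ball_subset_ball (min_le_right _ _) hz),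
      closedBall_subset_closedBall hρρ₀.le hw⟩
  have hz''b : z'' ∈ ball z' (min δ ρ₀) := by rwa [mem_ball, dist_comm]
  refine extendsAt_of_slice hUE hf hE hρ (z'' := z'') (δ := min δ ρ₀) ?_ ?_ hz''b ?_
  · exact (prod_mono_right ball_subset_closedBall).trans
      (hsubW.trans (inter_subset_left.trans b.W_subset))
  · rintro ⟨z, w⟩ ⟨hz, hw⟩
    exact huv ⟨hδu (ball_subset_ball (min_le_left _ _) hz), hwv hw⟩
  · intro w hw
    obtain ⟨hwW, hwr⟩ := hsubW (mk_mem_prod hz''b hw)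
    have h1 : ExtendsAt U E f (z'', b.g (z'', b.τ (z'', w))) :=
      (hz''A _ (ball_subset_closedBall hwr)).2
    have h2 := b.g_τ _ hwW
    simp only at h2
    rwa [h2] at h1

end GraphBox

/-- Inverse function theorem for `(z, w) ↦ (z, σ (z, w))`: its derivative is injective because `σ'`
is injective on the vertical axis. The Lipschitz bounds come from `C¹` regularity of the map and of
its local inverse. -/
theorem GraphBox.exists_of_contDiffAt {U E S : Set (ℂ × ℂ)} {σ : ℂ × ℂ → ℂ} {y₀ : ℂ × ℂ}
    {σ' : ℂ × ℂ →L[ℝ] ℂ} (hS : S ∈ 𝓝 y₀) (hSU : S ⊆ U) (hσ : ContDiffAt ℝ 1 σ y₀)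
    (hσ' : HasFDerivAt σ σ' y₀) (hinj : ∀ w, σ' (0, w) = 0 → w = 0)
    (hsat : ∀ x ∈ S, ∀ y ∈ S, σ x = σ y → x ∈ E → y ∈ E) :
    ∃ b : GraphBox U E, b.τ = σ ∧ y₀ ∈ b.W := by
  set D : ℂ × ℂ →L[ℝ] ℂ × ℂ := (ContinuousLinearMap.fst ℝ ℂ ℂ).prod σ' with hD
  have hDinj : Function.Injective (D : ℂ × ℂ →ₗ[ℝ] ℂ × ℂ) := by
    rw [injective_iff_map_eq_zero]
    rintro ⟨z, w⟩ h
    have h1 : z = 0 := congrArg Prod.fst h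
    have h2 : σ' (z, w) = 0 := congrArg Prod.snd h
    subst h1
    rw [hinj w h2]
    rfl
  set D' : (ℂ × ℂ) ≃L[ℝ] ℂ × ℂ :=
    (LinearEquiv.ofInjectiveEndo (D : ℂ × ℂ →ₗ[ℝ] ℂ × ℂ) hDinj).toContinuousLinearEquiv with hD'
  have hDD' : (D' : ℂ × ℂ →L[ℝ] ℂ × ℂ) = D := by
    ext x <;> rfl
  have hχ : ContDiffAt ℝ 1 (fun y : ℂ × ℂ => (y.1, σ y)) y₀ := contDiffAt_fst.prodMk hσ
  have hχ' : HasFDerivAt (fun y : ℂ × ℂ => (y.1, σ y)) (D' : ℂ × ℂ →L[ℝ] ℂ × ℂ) y₀ := by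
    rw [hDD']
    exact hasFDerivAt_fst.prodMk hσ'
  set χ := hχ.toOpenPartialHomeomorph _ hχ' one_ne_zero with hχdef
  have hχc : ∀ y, χ y = (y.1, σ y) := fun y => rfl
  have hy₀ : y₀ ∈ χ.source := hχ.mem_toOpenPartialHomeomorph_source hχ' one_ne_zero
  have hsymm : ContDiffAt ℝ 1 χ.symm (χ y₀) := hχ.to_localInverse hχ' one_ne_zero
  obtain ⟨K₁, N₁, hN₁, hL₁⟩ := hσ.exists_lipschitzOnWith
  obtain ⟨K₂, N₂, hN₂, hL₂⟩ := hsymm.exists_lipschitzOnWith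
  have hnhds : N₂ ∩ (χ.target ∩ χ.symm ⁻¹' (N₁ ∩ S)) ∈ 𝓝 (χ y₀) := by
    refine inter_mem hN₂ (inter_mem (χ.open_target.mem_nhds (χ.map_source hy₀)) ?_)
    refine (χ.continuousAt_symm (χ.map_source hy₀)).preimage_mem_nhds ?_
    rw [χ.left_inv hy₀]
    exact inter_mem hN₁ hS
  obtain ⟨r, hr, hrN⟩ := Metric.mem_nhds_iff.1 hnhds
  rw [show χ y₀ = (y₀.1, σ y₀) from rfl, ← ball_prod_same] at hrN
  have hmem : ∀ z ∈ ball y₀.1 r, ∀ t ∈ ball (σ y₀) r, (z, (χ.symm (z, t)).2) = χ.symm (z, t) ∧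
      χ.symm (z, t) ∈ χ.source ∧ χ (χ.symm (z, t)) = (z, t) := by
    intro z hz t ht
    have h1 := (hrN (mk_mem_prod hz ht)).2.1
    have h2 := χ.right_inv h1
    exact ⟨Prod.ext (congrArg Prod.fst h2).symm rfl, χ.map_target h1, h2⟩
  have hWS : χ.source ∩ χ ⁻¹' (ball y₀.1 r ×ˢ ball (σ y₀) r) ⊆ N₁ ∩ S := by
    rintro x ⟨hx, hx'⟩
    have h1 := (hrN hx').2.2
    rwa [mem_preimage, χ.left_inv hx] at h1
  refine ⟨{
    B := ball y₀.1 r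
    T := ball (σ y₀) r
    W := χ.source ∩ χ ⁻¹' (ball y₀.1 r ×ˢ ball (σ y₀) r)
    τ := σ
    g := fun x => (χ.symm x).2
    Kτ := K₁
    Kg := 1 * K₂
    isOpen_B := isOpen_ball
    isPreconnected_B := (convex_ball _ _).isPreconnected
    nonempty_B := ⟨_, mem_ball_self hr⟩
    isOpen_T := isOpen_ball
    isOpen_W := χ.isOpen_inter_preimage (isOpen_ball.prod isOpen_ball)
    W_subset := fun x hx => hSU (hWS hx).2
    graph_mem := fun z hz t ht => ?_
    τ_graph := fun z hz t ht => ?_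
    fst_mem := fun x hx => hx.2.1
    τ_mem := fun x hx => hx.2.2
    g_τ := fun x hx => ?_
    lipschitz_τ := hL₁.mono fun x hx => (hWS hx).1
    lipschitz_g := LipschitzWith.prod_snd.comp_lipschitzOnWith (hL₂.mono fun x hx => (hrN hx).1)
    saturated := fun x hx y hy => hsat x (hWS hx).2 y (hWS hy).2 }, rfl, hy₀, ?_⟩
  · obtain ⟨h1, h2, h3⟩ := hmem z hz t ht
    rw [h1]
    exact ⟨h2, by rw [mem_preimage, h3]; exact ⟨hz, ht⟩⟩
  · obtain ⟨h1, h2, h3⟩ := hmem z hz t ht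
    rw [h1]
    exact congrArg Prod.snd h3
  · have h := χ.left_inv hx.1
    rw [hχc] at h
    rw [h]
  · exact ⟨mem_ball_self hr, mem_ball_self hr⟩

/-! ### Complex-linear changes of coordinates -/

theorem ExtendsAt.map {X Y : Type*} [NormedAddCommGroup X] [NormedSpace ℂ X]
    [NormedAddCommGroup Y] [NormedSpace ℂ Y] {U E : Set X} {f : X → ℂ} {q : X} (e : X ≃L[ℂ] Y)
    (h : ExtendsAt U E f q) : ExtendsAt (e.symm ⁻¹' U) (e.symm ⁻¹' E) (f ∘ e.symm) (e q) := by
  obtain ⟨V, hV, hqV, hVU, F, hF, hFf⟩ := h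
  exact ⟨e.symm ⁻¹' V, hV.preimage e.symm.continuous, by simpa using hqV, preimage_mono hVU,
    F ∘ e.symm, hF.comp e.symm.differentiable.differentiableOn (mapsTo_preimage _ _),
    fun x hx => hFf hx⟩

theorem extendsAt_map_iff {X Y : Type*} [NormedAddCommGroup X] [NormedSpace ℂ X]
    [NormedAddCommGroup Y] [NormedSpace ℂ Y] {U E : Set X} {f : X → ℂ} {q : X} (e : X ≃L[ℂ] Y) :
    ExtendsAt (e.symm ⁻¹' U) (e.symm ⁻¹' E) (f ∘ e.symm) (e q) ↔ ExtendsAt U E f q := by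
  refine ⟨fun h => ?_, fun h => h.map e⟩
  have h1 := h.map e.symm
  simpa [← preimage_comp, Function.comp_def] using h1

/-- Every real plane in a complex plane is the graph of a real-linear map over the first axis in
suitable complex-linear coordinates. -/
theorem exists_continuousLinearEquiv_fst_injective {V : Type*} [NormedAddCommGroup V]
    [NormedSpace ℂ V] (hV : Module.finrank ℂ V = 2) {a b : V}
    (hab : ∀ x y : ℝ, (x : ℂ) • a + (y : ℂ) • b = 0 → x = 0 ∧ y = 0) :
    ∃ M : V ≃L[ℂ] ℂ × ℂ, ∀ x y : ℝ, (M ((x : ℂ) • a + (y : ℂ) • b)).1 = 0 → x = 0 ∧ y = 0 := by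
  have : FiniteDimensional ℂ V := FiniteDimensional.of_finrank_pos (by omega)
  -- In the basis `a, d` the first coordinate of `x • a + y • b` is `x + y * c`, which vanishes for
  -- real `x, y` only trivially once `c` is not real. If `b` is a complex multiple of `a`, the
  -- factor `c` is not real, by real independence; otherwise `d` can be adjusted to make `c = I`.
  obtain ⟨c, d, k, hc, hd, hb⟩ : ∃ (c : ℂ) (d : V) (k : ℂ), c.im ≠ 0 ∧
      LinearIndependent ℂ ![a, d] ∧ b = c • a + k • d := by
    by_cases hLI : LinearIndependent ℂ ![a, b]
    · refine ⟨Complex.I, b - Complex.I • a, 1, by simp, ?_, by module⟩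
      rw [LinearIndependent.pair_iff] at hLI ⊢
      intro s t hst
      obtain ⟨h1, h2⟩ := hLI (s - t * Complex.I) t (by rw [← hst]; module)
      subst h2
      simpa using h1
    · have ha : a ≠ 0 := fun ha => by
        simpa using (hab 1 0 (by simp [ha])).1
      obtain ⟨d, hd⟩ := exists_linearIndependent_pair_of_one_lt_finrank (R := ℂ) (M := V)
        (by omega) ha
      rw [LinearIndependent.pair_iff' ha] at hLI
      push Not at hLI
      obtain ⟨c, hc⟩ := hLI
      refine ⟨c, d, 0, fun him => ?_, hd, by simp [hc]⟩
      have hre : ((c.re : ℝ) : ℂ) = c := Complex.ext (by simp) (by simp [him])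
      have := (hab c.re (-1) (by rw [hre, ← hc]; simp)).2
      norm_num at this
  set β := basisOfLinearIndependentOfCardEqFinrank hd (by simp [hV]) with hβ
  set M : V ≃L[ℂ] ℂ × ℂ :=
    (β.equivFun.trans (LinearEquiv.finTwoArrow ℂ ℂ)).toContinuousLinearEquiv with hM
  have hβ0 : β 0 = a := by simp [hβ]
  have hβ1 : β 1 = d := by simp [hβ]
  have hMa : M a = (1, 0) := by
    rw [← hβ0]; simp [hM]
  have hMd : M d = (0, 1) := by
    rw [← hβ1]; simp [hM]
  refine ⟨M, fun x y h => ?_⟩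
  have h' : (x : ℂ) + y * c = 0 := by
    rw [hb, map_add, map_smul, map_smul, map_add, map_smul, map_smul, hMa, hMd] at h
    simpa using h
  have hy : y = 0 := by
    have := congrArg Complex.im h'
    simpa [hc] using this
  subst hy
  exact ⟨by simpa using h', rfl⟩

end General

/-! ### Propagation along the leaves of the foliation -/

theorem EuclideanSpace.interior_eq_empty_of_hausdorffMeasure_three {E : Set C2}
    (hE : Measure.hausdorffMeasure (3 : ℝ) E = 0) : interior E = ∅ := by
  refine interior_eq_empty_of_hausdorffMeasure_finrank
    (le_antisymm ((Measure.hausdorffMeasure_mono ?_ E).trans hE.le) zero_le)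
  have : Module.finrank ℝ C2 = 4 := by
    rw [finrank_real_of_complex]; simp
  rw [this]
  norm_num

namespace C1CurveFoliation
open Filter

variable {U : Set C2} (ℱ : C1CurveFoliation U)

variable {ℱ} in
theorem IsUnionOfLeaves.mem_of_samePlaque {E : Set C2} (hE : ℱ.IsUnionOfLeaves E) {x y : C2}
    (h : ℱ.SamePlaque x y) (hx : x ∈ E) : y ∈ E := by
  obtain ⟨S, -, rfl⟩ := hE
  simp only [mem_iUnion] at hx ⊢
  obtain ⟨s, hs, hsx⟩ := hx
  exact ⟨s, hs, Relation.ReflTransGen.tail hsx h⟩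

variable {E : Set C2} {f : C2 → ℂ}

/-- Holomorphic extendability propagates locally along plaques. -/
theorem eventually_extendsAt_of_plaque (hE : ℱ.IsUnionOfLeaves E) (hUE : IsOpen (U \ E))
    (hnull : Measure.hausdorffMeasure (3 : ℝ) E = 0) (hf : DifferentiableOn ℂ f (U \ E))
    {φ : OpenPartialHomeomorph C2 (ℂ × ℂ)} (hφ : φ ∈ ℱ.atlas) {q : C2} (hq : q ∈ φ.source) :
    ∃ N ∈ 𝓝 q, ∀ q₁ ∈ N, ∀ q₂ ∈ N, (φ q₁).2 = (φ q₂).2 →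
      ExtendsAt U E f q₁ → ExtendsAt U E f q₂ := by
  have hc : ContDiffAt ℝ 1 φ q := (ℱ.contDiffOn φ hφ).contDiffAt (φ.open_source.mem_nhds hq)
  have hcs : ContDiffAt ℝ 1 φ.symm (φ q) :=
    (ℱ.contDiffOn_symm φ hφ).contDiffAt (φ.open_target.mem_nhds (φ.map_source hq))
  have hA := (hc.differentiableAt one_ne_zero).hasFDerivAt
  have hA' := (hcs.differentiableAt one_ne_zero).hasFDerivAt
  set A := fderiv ℝ φ q
  set A' := fderiv ℝ φ.symm (φ q)
  have hA'A : A'.comp A = ContinuousLinearMap.id ℝ C2 := by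
    refine (hA'.comp q hA).unique ((hasFDerivAt_id q).congr_of_eventuallyEq ?_)
    filter_upwards [φ.open_source.mem_nhds hq] with x hx using φ.left_inv hx
  have hAA' : A.comp A' = ContinuousLinearMap.id ℝ (ℂ × ℂ) := by
    rw [← φ.left_inv hq] at hA
    refine (hA.comp (φ q) (by simpa only [φ.left_inv hq] using hA')).unique
      ((hasFDerivAt_id (φ q)).congr_of_eventuallyEq ?_)
    filter_upwards [φ.open_target.mem_nhds (φ.map_source hq)] with x hx using φ.right_inv hx
  have hAA'x : ∀ x, A (A' x) = x := fun x => congrArg (fun L => L x) hAA'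
  have hA'Ax : ∀ x, A' (A x) = x := fun x => congrArg (fun L => L x) hA'A
  have hlin : ∀ x y : ℝ, A' ((x : ℂ) + y * Complex.I, 0) =
      (x : ℂ) • A' (1, 0) + (y : ℂ) • A' (Complex.I, 0) := by
    intro x y
    rw [Complex.coe_smul, Complex.coe_smul, ← map_smul, ← map_smul, ← map_add]
    congr 1
    simp
  -- `A' (1, 0)` and `A' (I, 0)` span the tangent plane at `q` of the plaque through `q`; in the
  -- coordinates `M` it is a graph over the first axis.
  obtain ⟨M, hM⟩ := exists_continuousLinearEquiv_fst_injective (V := C2) (by simp)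
    (a := A' (1, 0)) (b := A' (Complex.I, 0)) (fun x y hxy => by
      rw [← hlin] at hxy
      have h1 := hAA'x ((x : ℂ) + y * Complex.I, 0)
      rw [hxy, map_zero] at h1
      have h2 : (0 : ℂ) = x + y * Complex.I := congrArg Prod.fst h1
      exact ⟨by simpa using (congrArg Complex.re h2).symm,
        by simpa using (congrArg Complex.im h2).symm⟩)
  set Ms : ℂ × ℂ →L[ℝ] C2 := (M.symm : ℂ × ℂ →L[ℂ] C2).restrictScalars ℝ with hMs
  set σ : ℂ × ℂ → ℂ := fun y => (φ (M.symm y)).2 with hσdef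
  set S : Set (ℂ × ℂ) := M.symm ⁻¹' φ.source with hSdef
  have hSo : S ∈ 𝓝 (M q) :=
    (φ.open_source.preimage M.symm.continuous).mem_nhds (by simpa [hSdef] using hq)
  have hc' : ContDiffAt ℝ 1 φ (Ms (M q)) := by simpa [hMs] using hc
  have hA2 : HasFDerivAt φ A (Ms (M q)) := by simpa [hMs] using hA
  have hσ : ContDiffAt ℝ 1 σ (M q) :=
    contDiff_snd.contDiffAt.comp (M q) (hc'.comp (M q) Ms.contDiff.contDiffAt)
  have hσ' : HasFDerivAt σ ((ContinuousLinearMap.snd ℝ ℂ ℂ).comp (A.comp Ms)) (M q) :=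
    hasFDerivAt_snd.comp (M q) (hA2.comp (M q) Ms.hasFDerivAt)
  obtain ⟨b, hbτ, hbW⟩ := GraphBox.exists_of_contDiffAt (U := M.symm ⁻¹' U)
    (E := M.symm ⁻¹' E) hSo (preimage_mono (ℱ.source_subset φ hφ)) hσ hσ' (fun w hw => by
      -- The vector `v` is killed by the transverse derivative, so it is tangent to the plaque; its
      -- first `M`-coordinate is zero, so `v = 0`.
      set v : C2 := M.symm (0, w) with hv
      have h2 : (A v).2 = 0 := hw
      have hv1 : v = ((A v).1.re : ℂ) • A' (1, 0) + ((A v).1.im : ℂ) • A' (Complex.I, 0) := by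
        rw [← hlin, Complex.re_add_im, ← h2]
        exact (hA'Ax v).symm
      obtain ⟨h3, h4⟩ := hM (A v).1.re (A v).1.im (by rw [← hv1, hv]; simp)
      rw [h3, h4] at hv1
      have hv0 : M v = 0 := by rw [hv1]; simp
      rw [hv, M.apply_symm_apply] at hv0
      exact congrArg Prod.snd hv0)
    (fun x hx y hy hxy hxE => hE.mem_of_samePlaque ⟨φ, hφ, σ y, ⟨hx, hxy⟩, hy, rfl⟩ hxE)
  refine ⟨M ⁻¹' b.W, (b.isOpen_W.preimage M.continuous).mem_nhds hbW, ?_⟩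
  intro q₁ hq₁ q₂ hq₂ h12 hext
  rw [← extendsAt_map_iff M] at hext ⊢
  have hst : b.τ (M q₁) = b.τ (M q₂) := by simpa [hbτ, hσdef] using h12
  have hnull' : Measure.hausdorffMeasure (3 : ℝ) (M.symm ⁻¹' E) = 0 := by
    have h1 : M.symm ⁻¹' E = M '' E := (M.image_eq_preimage_symm E).symm
    rw [h1]
    exact (M.lipschitz.lipschitzOnWith (s := univ)).hausdorffMeasure_image_eq_zero
      (subset_univ _) (by norm_num) hnull
  have key := b.extendsAt_graph (f := f ∘ M.symm) (z₁ := (M q₁).1) (z₂ := (M q₂).1)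
    (t₀ := b.τ (M q₁)) (hUE.preimage M.symm.continuous)
    (hf.comp M.symm.differentiable.differentiableOn (mapsTo_preimage _ _)) hnull'
    (b.fst_mem _ hq₁) (b.fst_mem _ hq₂) (b.τ_mem _ hq₁)
    (by rw [b.g_τ _ hq₁]; exact hext)
  rw [hst, b.g_τ _ hq₂] at key
  exact key

/-- Holomorphic extendability propagates along plaques. -/
theorem extendsAt_of_samePlaque (hE : ℱ.IsUnionOfLeaves E) (hUE : IsOpen (U \ E))
    (hnull : Measure.hausdorffMeasure (3 : ℝ) E = 0) (hf : DifferentiableOn ℂ f (U \ E))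
    {x y : C2} (hxy : ℱ.SamePlaque x y) (hx : ExtendsAt U E f x) : ExtendsAt U E f y := by
  obtain ⟨φ, hφ, t, ⟨hxs, hxt⟩, hys, hyt⟩ := hxy
  obtain ⟨D, T, -, hD, -, hDT⟩ := ℱ.box φ hφ
  have hmem : ∀ u ∈ φ.source, φ u ∈ D ×ˢ T := fun u hu => hDT ▸ φ.map_source hu
  have htT : t ∈ T := hxt ▸ (hmem x hxs).2
  have htarget : ∀ d ∈ D, (d, t) ∈ φ.target := fun d hd => hDT ▸ ⟨hd, htT⟩
  -- Along the plaque, parametrized by the connected set `D`, extendability is locally constant,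
  -- hence constant.
  have key := hD.isPreconnected.induction₂
    (fun d d' => ExtendsAt U E f (φ.symm (d, t)) ↔ ExtendsAt U E f (φ.symm (d', t)))
    (fun d hd => by
      obtain ⟨N, hN, hprop⟩ := ℱ.eventually_extendsAt_of_plaque hE hUE hnull hf hφ
        (φ.map_target (htarget d hd))
      have hcont : Tendsto (fun d' => φ.symm (d', t)) (𝓝[D] d) (𝓝 (φ.symm (d, t))) :=
        ((φ.continuousAt_symm (htarget d hd)).comp
          (f := fun d' : ℂ => (d', t)) (by fun_prop)).tendsto.mono_left nhdsWithin_le_nhds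
      filter_upwards [hcont hN, self_mem_nhdsWithin] with d' hd' hd'D
      have heq : (φ (φ.symm (d, t))).2 = (φ (φ.symm (d', t))).2 := by
        rw [φ.right_inv (htarget d hd), φ.right_inv (htarget d' hd'D)]
      exact ⟨hprop _ (mem_of_mem_nhds hN) _ hd' heq,
        hprop _ hd' _ (mem_of_mem_nhds hN) heq.symm⟩)
    (fun _ _ _ _ _ _ h h' => h.trans h') (fun _ _ _ _ h => h.symm)
    (hmem x hxs).1 (hmem y hys).1
  have hx' : φ.symm ((φ x).1, t) = x := by rw [← hxt]; exact φ.left_inv hxs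
  have hy' : φ.symm ((φ y).1, t) = y := by rw [← hyt]; exact φ.left_inv hys
  rw [hx', hy'] at key
  exact key.1 hx

end C1CurveFoliation

theorem theorem5p13 (U : Set C2) (hU : IsOpen U) (hUconn : IsConnected U)
    (ℱ : C1CurveFoliation U)
    (E : Set C2) (hEleaves : ℱ.IsUnionOfLeaves E)
    (hEclosed : IsClosed ((↑) ⁻¹' E : Set U))
    (hEnull : Measure.hausdorffMeasure (3 : ℝ) E = 0)
    (f : C2 → ℂ) (hf : DifferentiableOn ℂ f (U \ E))
    (p : C2) (hp : p ∈ E) (hext : ExtendsHolomorphicallyNear U E f {p}) :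
    ExtendsHolomorphicallyNear U E f (ℱ.leaf p) := by
  have hUE : IsOpen (U \ E) := by
    obtain ⟨Z, hZ, hZE⟩ := isClosed_induced_iff.1 hEclosed
    have : U \ E = U \ Z := by
      ext x
      refine and_congr_right fun hx => not_congr ?_
      exact (Set.ext_iff.1 hZE ⟨x, hx⟩).symm
    rw [this]
    exact hU.sdiff hZ
  have hpext : ExtendsAt U E f p := by
    obtain ⟨V, hV, hpV, hVU, hF⟩ := hext
    exact ⟨V, hV, hpV rfl, hVU, hF⟩
  have hleaf : ∀ q ∈ ℱ.leaf p, ExtendsAt U E f q := by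
    intro q hq
    induction hq with
    | refl => exact hpext
    | tail _ h ih => exact ℱ.extendsAt_of_samePlaque hEleaves hUE hEnull hf h ih
  -- The neighbourhood of the leaf is the set of all points of extendability.
  obtain ⟨F, hF, hFf⟩ := exists_differentiableOn_extension (U := U) (f := f)
    (EuclideanSpace.interior_eq_empty_of_hausdorffMeasure_three hEnull)
  refine ⟨_, isOpen_setOf_extendsAt, hleaf, ?_, F, hF, hFf⟩
  rintro q ⟨V, -, hqV, hVU, -⟩
  exact hVU hqV
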